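/- Let $(\Omega,\mathcal F,P)$ be a probability space and let $L^\infty_{++}$ be the set of ($P$-a.s. classes of) random variables $X\in L^\infty(P)$ with $X\ge c$ $P$-a.s. for some constant $c>0$, i.e. $X>0$ and $\log X\in L^\infty(P)$. Let $\mathcal Q_P$ be the set of all probability measures on $(\Omega,\mathcal F)$ that are absolutely continuous with respect to $P$. Let $\tilde\rho\colon L^\infty_{++}\to[0,\infty]$ be any mapping. Call $\tilde\rho$ * monotone if $X\le Y$ $P$-a.s. implies $\tilde\rho(X)\le\tilde\rho(Y)$; * quasi-logconvex if $\tilde\rho(X^{\alpha}Y^{1-\alpha})\le\max\{\tilde\rho(X),\tilde\rho(Y)\}$ for all $X,Y\in L^\infty_{++}$, $\alpha\in(0,1)$; * star-shaped if $\tilde\rho(\lambda X)\ge\lambda\tilde\rho(X)$ for all $\lambda\ge1$, $X\in L^\infty_{++}$; * continuous from below if $\tilde\rho(X_n)\to\tilde\rho(X)$ whenever $X_n,X\in L^\infty_{++}$ and $X_n\uparrow X$ $P$-a.s. **Theorem.** The following statements are equivalent. (a) $\tilde\rho$ is monotone, quasi-logconvex, star-shaped and continuous from below. (b) With $\mathcal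 Q=\mathcal Q_P$, there is $\mathfrak R\colon\mathbb R\times\mathcal Q\to[-\infty,\infty]$ such that, for every $Q\in\mathcal Q$, $t\mapsto\mathfrak R(t;Q)$ is increasing, continuous from below (left-continuous) and expansive, i.e. $\mathfrak R(t+h;Q)\ge\mathfrak R(t;Q)+h$ for all $t\in\mathbb R$, $h\ge0$, and $$\tilde\rho(X)=\sup_{Q\in\mathcal Q}\exp\bigl(\mathfrak R(\mathbb E_Q[\log X];Q)\bigr)\qquad\text{for all }X\in L^\infty_{++}. \tag{1}$$ (c) With $\mathcal Q=\mathcal Q_P$, there is $\tilde{\mathfrak R}\colon\mathbb R\times\mathcal Q\to[0,\infty]$ such that, for every $Q\in\mathcal Q$, $t\mapsto\tilde{\mathfrak R}(t;Q)$ is increasing, continuous from below and multiplicatively expansive, i.e. $\tilde{\mathfrak R}(t+h;Q)\ge e^{h}\tilde{\mathfrak R}(t;Q)$ for all $t\in\mathbb R$, $h\ge0$, and $\tilde\rho(X)=\sup_{Q\in\mathcal Q}\tilde{\mathfrak R}(\mathbb E_Q[\log X];Q)$ for all $X\in L^\infty_{++}$. Statements (b) and (c) are also equivalent to the versions of themselves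 in which $\mathcal Q$ is only required to be some subset of $\mathcal Q_P$. For any $\mathfrak R\colon\mathbb R\times\mathcal Q\to[-\infty,\infty]$, $\mathfrak R$ is expansive if and only if $\exp(\mathfrak R)$ is multiplicatively expansive. Finally, if (a) holds, then the functional $$\mathfrak R(t;Q)=\inf\{\log\tilde\rho(Y): Y\in L^\infty_{++},\ \mathbb E_Q[\log Y]\ge t\},\qquad t\in\mathbb R,\ Q\in\mathcal Q_P,$$ is increasing and expansive in $t$ and satisfies (1) with $\mathcal Q=\mathcal Q_P$. -/

import Mathlib

open MeasureTheory Filter Topology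
open scoped ENNReal

noncomputable section

variable {Ω : Type*} [MeasurableSpace Ω]

/-- The cone of `X` in `L^∞(P)` that are bounded away from zero,
that is, the `X > 0` with `log X` again in `L^∞(P)`. -/
def LinftyPP (P : Measure Ω) : Set (Lp ℝ ∞ P) :=
  {X | ∃ c : ℝ, 0 < c ∧ ∀ᵐ ω ∂P, c ≤ X ω}

namespace LinftyPP

variable {P : Measure Ω}

lemma memLp_of_bounds (f : Ω → ℝ) (hf : AEStronglyMeasurable f P)
    (hc : ∃ c : ℝ, 0 < c ∧ ∀ᵐ ω ∂P, c ≤ f ω) (hC : ∃ C : ℝ, ∀ᵐ ω ∂P, f ω ≤ C) :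
    MemLp f ∞ P := by
  obtain ⟨c, hc0, hc⟩ := hc
  obtain ⟨C, hC⟩ := hC
  refine memLp_top_of_bound hf C ?_
  filter_upwards [hc, hC] with ω h1 h2
  rw [Real.norm_eq_abs, abs_of_pos (hc0.trans_le h1)]
  exact h2

/-- The class of a measurable function with values in `[c, C]`, where `0 < c`. -/
def ofFun (f : Ω → ℝ) (hf : AEStronglyMeasurable f P)
    (hc : ∃ c : ℝ, 0 < c ∧ ∀ᵐ ω ∂P, c ≤ f ω) (hC : ∃ C : ℝ, ∀ᵐ ω ∂P, f ω ≤ C) :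
    LinftyPP P :=
  ⟨(memLp_of_bounds f hf hc hC).toLp f, by
    have hmem := memLp_of_bounds f hf hc hC
    obtain ⟨c, hc0, hc⟩ := hc
    refine ⟨c, hc0, ?_⟩
    filter_upwards [hc, hmem.coeFn_toLp] with ω h1 h2
    rw [h2]
    exact h1⟩

lemma coeFn_ofFun (f : Ω → ℝ) (hf : AEStronglyMeasurable f P)
    (hc : ∃ c : ℝ, 0 < c ∧ ∀ᵐ ω ∂P, c ≤ f ω) (hC : ∃ C : ℝ, ∀ᵐ ω ∂P, f ω ≤ C) :
    ((ofFun f hf hc hC : LinftyPP P) : Lp ℝ ∞ P) =ᵐ[P] f :=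
  MemLp.coeFn_toLp (memLp_of_bounds f hf hc hC)

lemma exists_upper (X : LinftyPP P) : ∃ C : ℝ, ∀ᵐ ω ∂P, (X : Lp ℝ ∞ P) ω ≤ C := by
  refine ⟨(eLpNormEssSup (X : Lp ℝ ∞ P) P).toReal, ?_⟩
  have hfin : eLpNormEssSup (X : Lp ℝ ∞ P) P ≠ ∞ := by
    have h := (Lp.memLp (X : Lp ℝ ∞ P)).eLpNorm_ne_top
    rwa [eLpNorm_exponent_top] at h
  filter_upwards [ae_le_eLpNormEssSup (f := (X : Lp ℝ ∞ P)) (μ := P)] with ω h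
  have h' := ENNReal.toReal_mono hfin h
  rw [toReal_enorm] at h'
  exact (le_abs_self _).trans h'

/-- The position `l X`, for a real `l > 0`. -/
def scale (l : ℝ) (hl : 0 < l) (X : LinftyPP P) : LinftyPP P :=
  ofFun (fun ω => l * (X : Lp ℝ ∞ P) ω)
    ((Lp.aestronglyMeasurable (X : Lp ℝ ∞ P)).const_mul l)
    (by
      obtain ⟨c, hc0, hc⟩ := X.2
      refine ⟨l * c, mul_pos hl hc0, ?_⟩
      filter_upwards [hc] with ω h
      exact mul_le_mul_of_nonneg_left h hl.le)
    (by
      obtain ⟨C, hC⟩ := exists_upper X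
      refine ⟨l * C, ?_⟩
      filter_upwards [hC] with ω h
      exact mul_le_mul_of_nonneg_left h hl.le)

/-- The position `X ^ a * Y ^ (1 - a)`, for `0 < a < 1`. -/
def geom (a : ℝ) (h0 : 0 < a) (h1 : a < 1) (X Y : LinftyPP P) : LinftyPP P :=
  ofFun (fun ω => ((X : Lp ℝ ∞ P) ω) ^ a * ((Y : Lp ℝ ∞ P) ω) ^ (1 - a))
    (((Lp.aestronglyMeasurable (X : Lp ℝ ∞ P)).aemeasurable.pow_const a).mul
      ((Lp.aestronglyMeasurable (Y : Lp ℝ ∞ P)).aemeasurable.pow_const (1 - a))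
        |>.aestronglyMeasurable)
    (by
      obtain ⟨c, hc0, hc⟩ := X.2
      obtain ⟨d, hd0, hd⟩ := Y.2
      refine ⟨c ^ a * d ^ (1 - a), by positivity, ?_⟩
      filter_upwards [hc, hd] with ω h h'
      have h1' : 0 ≤ 1 - a := by linarith
      have := hc0.trans_le h
      gcongr)
    (by
      obtain ⟨c, hc0, hc⟩ := X.2
      obtain ⟨d, hd0, hd⟩ := Y.2
      obtain ⟨C, hC⟩ := exists_upper X
      obtain ⟨D, hD⟩ := exists_upper Y
      refine ⟨C ^ a * D ^ (1 - a), ?_⟩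
      filter_upwards [hc, hd, hC, hD] with ω h h' h2 h2'
      have h1' : 0 ≤ 1 - a := by linarith
      have hX := hc0.trans_le h
      have hY := hd0.trans_le h'
      have hC0 := hX.trans_le h2
      gcongr)

/-- `E_Q[log X]`; for `Q ≪ P` a probability measure, `log X` is `Q`-a.s. bounded. -/
def meanLog (Q : Measure Ω) (X : LinftyPP P) : ℝ :=
  ∫ ω, Real.log ((X : Lp ℝ ∞ P) ω) ∂Q

end LinftyPP

/-! Properties of a risk measure on the cone, with values in `[0, ∞]`. -/

section RiskMeasure

variable {P : Measure Ω}

def IsMonotoneRisk (ρ : LinftyPP P → ℝ≥0∞) : Prop :=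
  ∀ X Y : LinftyPP P,
    (∀ᵐ ω ∂P, (X : Lp ℝ ∞ P) ω ≤ (Y : Lp ℝ ∞ P) ω) → ρ X ≤ ρ Y

def IsQuasiLogconvex (ρ : LinftyPP P → ℝ≥0∞) : Prop :=
  ∀ (X Y : LinftyPP P) (a : ℝ) (h0 : 0 < a) (h1 : a < 1),
    ρ (LinftyPP.geom a h0 h1 X Y) ≤ max (ρ X) (ρ Y)

def IsStarShaped (ρ : LinftyPP P → ℝ≥0∞) : Prop :=
  ∀ (X : LinftyPP P) (l : ℝ) (hl : 1 ≤ l),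
    ENNReal.ofReal l * ρ X ≤ ρ (LinftyPP.scale l (zero_lt_one.trans_le hl) X)

/-- If `X n ↑ X` almost surely, all in the cone, then `ρ (X n) → ρ X`. -/
def IsContinuousFromBelow (ρ : LinftyPP P → ℝ≥0∞) : Prop :=
  ∀ (Xs : ℕ → LinftyPP P) (X : LinftyPP P),
    (∀ᵐ ω ∂P, Monotone (fun n => (Xs n : Lp ℝ ∞ P) ω)) →
    (∀ᵐ ω ∂P, Tendsto (fun n => (Xs n : Lp ℝ ∞ P) ω) atTop (𝓝 ((X : Lp ℝ ∞ P) ω))) →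
    Tendsto (fun n => ρ (Xs n)) atTop (𝓝 (ρ X))

end RiskMeasure

/-- All probability measures that are absolutely continuous with respect to `P`. -/
def acProb (P : Measure Ω) : Set (Measure Ω) :=
  {Q | IsProbabilityMeasure Q ∧ Q ≪ P}

/-- `R (t; Q)` is increasing in `t`, for every `Q`. -/
def IsIncreasingFst {S β : Type*} [Preorder β] (R : ℝ → S → β) : Prop :=
  ∀ Q : S, Monotone (fun t => R t Q)

/-- `R (t; Q)` is continuous from below (left-continuous) in `t`, for every `Q`. -/
def IsContinuousFromBelowFst {S β : Type*} [TopologicalSpace β] (R : ℝ → S → β) : Prop :=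
  ∀ (Q : S) (t : ℝ), ContinuousWithinAt (fun s => R s Q) (Set.Iic t) t

/-- `R (t + h; Q) ≥ R (t; Q) + h` for `h ≥ 0`. -/
def IsExpansive {S : Type*} (R : ℝ → S → EReal) : Prop :=
  ∀ (t h : ℝ) (Q : S), 0 ≤ h → R t Q + (h : EReal) ≤ R (t + h) Q

/-- `R (t + h; Q) ≥ e^h R (t; Q)` for `h ≥ 0`. -/
def IsMulExpansive {S : Type*} (R : ℝ → S → ℝ≥0∞) : Prop :=
  ∀ (t h : ℝ) (Q : S), 0 ≤ h → ENNReal.ofReal (Real.exp h) * R t Q ≤ R (t + h) Q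

/-- `ρ X = sup_{Q ∈ 𝒬} R (E_Q[log X]; Q)` for all `X`. -/
def IsRepresentedBy {P : Measure Ω} (ρ : LinftyPP P → ℝ≥0∞) (𝒬 : Set (Measure Ω))
    (R : ℝ → 𝒬 → ℝ≥0∞) : Prop :=
  ∀ X : LinftyPP P, ρ X = ⨆ Q : 𝒬, R (LinftyPP.meanLog (Q : Measure Ω) X) Q

/-- `inf {log (ρ Y) : E_Q[log Y] ≥ t}`, the infimum taken in `[-∞, ∞]`. -/
def canonicalR {P : Measure Ω} (ρ : LinftyPP P → ℝ≥0∞) (t : ℝ) (Q : acProb P) : EReal :=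
  ⨅ (Y : LinftyPP P) (_ : t ≤ LinftyPP.meanLog (Q : Measure Ω) Y), ENNReal.log (ρ Y)

end

/-! In the variable `z = log X`, the risk `z ↦ ρ (exp z)` is increasing and quasiconvex on `L^∞(P)`,
so the theorem is quasiconvex duality. If `m' < ρ X`, then `log X` lies outside the sublevel set at
`m'`. That set is convex, solid downwards and closed under bounded a.s. convergence, because the
infima of the tails of a sequence increase to its limit. Separating by some `Q ≪ P` shows that
`E_Q[log Y] ≥ E_Q[log X]` forces `ρ Y > m'`. This is `risk_eq_iSup_iInf`, the representation by
`canonicalR`; star-shapedness becomes expansivity by rescaling `Y`.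

The separating functional must be countably additive, not merely norm continuous
(`exists_isOrderContinuous_separating`). A Krein–Šmulian type construction in `L²(P)` gives a convex
`U` disjoint from the set and containing an `L²` neighbourhood of `0` inside each bounded ball.
Hahn–Banach applied to `U` then yields continuity along bounded a.s. convergent sequences, and
solidity makes the functional positive, hence a multiple of some `E_Q`.

Left continuity is obtained by passing to left limits in `t`. The supremum is unchanged because `ρ`
is continuous from below along `e^(-1/(n+1)) X ↑ X`. Conversely, each property in (a) passes through
the supremum over any set of measures. -/

noncomputable section

variable {Ω : Type*} [MeasurableSpace Ω]

/-! ### Convex sets in Hilbert space: strict separation and graded neighbourhoods of `0` -/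

section Hilbert

variable {H : Type*} [NormedAddCommGroup H] [InnerProductSpace ℝ H] [CompleteSpace H]

/-- A decreasing sequence of nonempty closed convex bounded sets in a Hilbert space has a
common point. -/
lemma nonempty_iInter_of_antitone_convex {K : ℕ → Set H} (hanti : Antitone K)
    (hclosed : ∀ n, IsClosed (K n)) (hconv : ∀ n, Convex ℝ (K n)) (hne : ∀ n, (K n).Nonempty)
    (hbdd : Bornology.IsBounded (K 0)) : (⋂ n, K n).Nonempty := by
  have hmin : ∀ n, ∃ v ∈ K n, ∀ w ∈ K n, ‖v‖ ≤ ‖w‖ := by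
    intro n
    obtain ⟨v, hv, h⟩ := exists_norm_eq_iInf_of_complete_convex (hne n) (hclosed n).isComplete
      (hconv n) 0
    refine ⟨v, hv, fun w hw => ?_⟩
    have h2 : (⨅ w : K n, ‖0 - (w : H)‖) ≤ ‖0 - w‖ :=
      ciInf_le ⟨0, Set.forall_mem_range.2 fun _ => norm_nonneg _⟩ (⟨w, hw⟩ : K n)
    rw [← h] at h2
    simpa using h2
  choose x hx hxmin using hmin
  have hmono : Monotone fun n => ‖x n‖ ^ 2 := fun m n hmn =>
    pow_le_pow_left₀ (norm_nonneg _) (hxmin m _ (hanti hmn (hx n))) 2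
  obtain ⟨R, hR⟩ := hbdd.exists_norm_le
  have hbd : BddAbove (Set.range fun n => ‖x n‖ ^ 2) := by
    refine ⟨R ^ 2, Set.forall_mem_range.2 fun n => ?_⟩
    exact pow_le_pow_left₀ (norm_nonneg _) (hR _ (hanti (Nat.zero_le n) (hx n))) 2
  -- The midpoint of `x n` and `x m` lies in `K m`, so its norm is at least `‖x m‖`. The
  -- parallelogram law turns this into a Cauchy estimate, since the minimal norms increase and are
  -- bounded.
  have hpar : ∀ m n, m ≤ n → ‖x n - x m‖ ^ 2 ≤ 2 * (‖x n‖ ^ 2 - ‖x m‖ ^ 2) := by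
    intro m n hmn
    have hmid : (1 / 2 : ℝ) • x n + (1 / 2 : ℝ) • x m ∈ K m :=
      hconv m (hanti hmn (hx n)) (hx m) (by norm_num) (by norm_num) (by norm_num)
    have h1 := hxmin m _ hmid
    rw [← smul_add, norm_smul, Real.norm_of_nonneg (by norm_num)] at h1
    have h2 := parallelogram_law_with_norm ℝ (x n) (x m)
    have h3 : 2 * ‖x m‖ ≤ ‖x n + x m‖ := by linarith
    have h4 := pow_le_pow_left₀ (by positivity) h3 2
    nlinarith
  have hcauchy : CauchySeq x := by
    rw [Metric.cauchySeq_iff']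
    intro ε hε
    have hlim := tendsto_atTop_ciSup hmono hbd
    have hev := hlim.eventually (lt_mem_nhds (show (⨆ n, ‖x n‖ ^ 2) - ε ^ 2 / 2 < _ by
      have := pow_pos hε 2
      linarith))
    obtain ⟨N, hN⟩ := hev.exists
    refine ⟨N, fun n hn => ?_⟩
    have h1 := hpar N n hn
    have h2 : ‖x n‖ ^ 2 ≤ ⨆ n, ‖x n‖ ^ 2 := le_ciSup hbd n
    rw [dist_eq_norm]
    refine lt_of_pow_lt_pow_left₀ 2 hε.le ?_
    linarith
  obtain ⟨a, ha⟩ := cauchySeq_tendsto_of_complete hcauchy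
  refine ⟨a, Set.mem_iInter.2 fun n => ?_⟩
  exact (hclosed n).mem_of_tendsto ha (eventually_atTop.2 ⟨n, fun m hm => hanti hm (hx m)⟩)

/-- At distance zero, `A` would meet every thickening of `B`. These intersections are bounded,
closed, convex and decreasing, so they have a common point, which lies in `A` and in the closure of
`B`. -/
lemma exists_pos_le_norm_sub_of_disjoint {A B : Set H} (hA : IsClosed A) (hAc : Convex ℝ A)
    (hAb : Bornology.IsBounded A) (hB : IsClosed B) (hBc : Convex ℝ B) (hAB : Disjoint A B) :
    ∃ δ : ℝ, 0 < δ ∧ ∀ a ∈ A, ∀ b ∈ B, δ ≤ ‖a - b‖ := by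
  by_contra! hcon
  have hB' : closure B = B := hB.closure_eq
  have hpos : ∀ n : ℕ, (0 : ℝ) < 1 / ((n : ℝ) + 1) := fun n => Nat.one_div_pos_of_nat
  obtain ⟨z, hz⟩ := nonempty_iInter_of_antitone_convex
    (K := fun n : ℕ => A ∩ Metric.cthickening (1 / ((n : ℝ) + 1)) B)
    (fun m n hmn => Set.inter_subset_inter_right _
      (Metric.cthickening_mono (Nat.one_div_le_one_div hmn) _))
    (fun n => hA.inter Metric.isClosed_cthickening)
    (fun n => hAc.inter (hBc.cthickening _))
    (fun n => by
      obtain ⟨a, ha, b, hb, hab⟩ := hcon _ (hpos n)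
      refine ⟨a, ha, Metric.mem_cthickening_of_dist_le a b _ _ hb ?_⟩
      rw [dist_eq_norm]
      exact hab.le)
    (hAb.subset Set.inter_subset_left)
  rw [Set.mem_iInter] at hz
  refine Set.disjoint_left.1 hAB (hz 0).1 ?_
  rw [← hB', Metric.closure_eq_iInter_cthickening]
  refine Set.mem_iInter₂.2 fun ε hε => ?_
  obtain ⟨n, hn⟩ := exists_nat_one_div_lt hε
  exact Metric.cthickening_mono hn.le _ (hz n).2

-- A point `x` outside `A + B` makes `A` and `x - B` disjoint, hence a positive distance apart, so
-- `x` is not in the closure.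
open scoped Pointwise in
lemma IsClosed.add_of_convex_of_isBounded {A B : Set H} (hA : IsClosed A) (hAc : Convex ℝ A)
    (hAb : Bornology.IsBounded A) (hB : IsClosed B) (hBc : Convex ℝ B) : IsClosed (A + B) := by
  refine isClosed_of_closure_subset fun x hx => ?_
  by_contra hxn
  have hpre : Convex ℝ ((fun a => x - a) ⁻¹' B) := by
    intro a ha b hb s t hs ht hst
    have h := hBc ha hb hs ht hst
    have heq : x - (s • a + t • b) = s • (x - a) + t • (x - b) := by
      rw [smul_sub, smul_sub, ← add_sub_add_comm, ← add_smul, hst, one_smul]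
    simpa only [Set.mem_preimage, heq] using h
  obtain ⟨δ, hδ, h⟩ := exists_pos_le_norm_sub_of_disjoint hA hAc hAb
    (hB.preimage (continuous_const.sub continuous_id)) hpre
    (Set.disjoint_left.2 fun a ha hb => hxn ⟨a, ha, x - a, hb, add_sub_cancel a x⟩)
  obtain ⟨y, ⟨a, ha, b, hb, rfl⟩, hy⟩ := Metric.mem_closure_iff.1 hx δ hδ
  have h1 := h a ha (x - b) (by simpa using hb)
  rw [dist_comm, dist_eq_norm] at hy
  have heq : a - (x - b) = a + b - x := by abel
  rw [heq] at h1
  exact absurd hy (not_lt.2 h1)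

open scoped Pointwise in
/-- A convex set `C` that avoids `0` and is closed on each set of a graded family of bounded
closed convex sets is disjoint from a convex set that contains a norm neighbourhood of `0` in
each set of the family. -/
lemma exists_convex_disjoint_of_isClosed_inter {B : ℕ → Set H} (hBclosed : ∀ n, IsClosed (B n))
    (hBconv : ∀ n, Convex ℝ (B n)) (hBbdd : ∀ n, Bornology.IsBounded (B n))
    (hB0 : ∀ n, (0 : H) ∈ B n) (hBadd : ∀ m n, B m + B n ⊆ B (m + n))
    {C : Set H} (hC : Convex ℝ C) (hCclosed : ∀ n, IsClosed (C ∩ B n)) (h0 : (0 : H) ∉ C) :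
    ∃ U : Set H, Convex ℝ U ∧ Disjoint U C ∧
      ∀ n, ∃ ε : ℝ, 0 < ε ∧ B n ∩ Metric.closedBall 0 ε ⊆ U := by
  -- Stages of an increasing construction of `U`: the grade `p.2` keeps each stage bounded, so only
  -- a closed piece of `C` matters at the next step.
  let good : Set H × ℕ → Prop := fun p =>
    p.1 ⊆ B p.2 ∧ IsClosed p.1 ∧ Convex ℝ p.1 ∧ (0 : H) ∈ p.1 ∧ Disjoint p.1 C
  have hstep : ∀ (k : ℕ) (p : {p // good p}), ∃ q : {p // good p}, p.1.1 ⊆ q.1.1 ∧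
      ∃ ε : ℝ, 0 < ε ∧ B k ∩ Metric.closedBall 0 ε ⊆ q.1.1 := by
    rintro k ⟨⟨S, N⟩, hSN, hS, hSc, hS0, hSC⟩
    simp only at hSN hS hSc hS0 hSC
    have hSb : Bornology.IsBounded S := (hBbdd N).subset hSN
    obtain ⟨δ, hδ, hsep⟩ := exists_pos_le_norm_sub_of_disjoint hS hSc hSb (hCclosed (N + k))
      (hC.inter (hBconv _)) (hSC.mono_right Set.inter_subset_left)
    -- With radius `δ / 2`, every point of `S + T` is closer than `δ` to `S`. It also lies in `B (N
    -- + k)`, so it cannot belong to `C`.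
    set T := B k ∩ Metric.closedBall (0 : H) (δ / 2) with hT
    have hT0 : (0 : H) ∈ T := ⟨hB0 k, by simpa using (half_pos hδ).le⟩
    have hsub : S + T ⊆ B (N + k) :=
      (Set.add_subset_add hSN Set.inter_subset_left).trans (hBadd N k)
    refine ⟨⟨(S + T, N + k), hsub,
      hS.add_of_convex_of_isBounded hSc hSb ((hBclosed k).inter Metric.isClosed_closedBall)
        ((hBconv k).inter (convex_closedBall _ _)),
      hSc.add ((hBconv k).inter (convex_closedBall _ _)), ⟨0, hS0, 0, hT0, by simp⟩, ?_⟩,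
      fun s hs => ⟨s, hs, 0, hT0, by simp⟩, δ / 2, by positivity,
      fun t ht => ⟨0, hS0, t, ht, by simp⟩⟩
    refine Set.disjoint_left.2 ?_
    rintro _ ⟨s, hs, t, ht, rfl⟩ hc
    have h1 := hsep s hs (s + t) ⟨hc, hsub ⟨s, hs, t, ht, rfl⟩⟩
    have h2 : ‖t‖ ≤ δ / 2 := by simpa using ht.2
    have h3 : ‖s - (s + t)‖ = ‖t‖ := by
      rw [sub_add_cancel_left, norm_neg]
    linarith
  choose next hsub hnext using hstep
  let S : ℕ → {p // good p} := fun n =>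
    Nat.rec ⟨({0}, 0), by simpa using hB0 0, isClosed_singleton, convex_singleton _, rfl,
      by simpa using h0⟩ (fun k p => next k p) n
  have hmono : Monotone fun n => (S n).1.1 := monotone_nat_of_le_succ fun n => hsub n (S n)
  refine ⟨⋃ n, (S n).1.1, hmono.directed_le.convex_iUnion fun n => (S n).2.2.2.1,
    Set.disjoint_iUnion_left.2 fun n => (S n).2.2.2.2.2, fun n => ?_⟩
  obtain ⟨ε, hε, h⟩ := hnext n (S n)
  -- The piece of `B n` is absorbed in passing from stage `n` to stage `n + 1`.
  exact ⟨ε, hε, h.trans (Set.subset_iUnion (fun n => (S n).1.1) (n + 1))⟩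

end Hilbert

/-! ### Order continuous separation in `L^∞(P)` by way of `L²(P)` -/

section Separation

variable {P : Measure Ω}

/-- The classes in `L²(P)` that are bounded by `r` in absolute value. -/
def essBall (P : Measure Ω) (r : ℝ) : Set (Lp ℝ 2 P) := {u | ∀ᵐ ω ∂P, |u ω| ≤ r}

lemma exists_subseq_ae_tendsto {us : ℕ → Lp ℝ 2 P} {u : Lp ℝ 2 P}
    (h : Tendsto us atTop (𝓝 u)) :
    ∃ ns : ℕ → ℕ, ∀ᵐ ω ∂P, Tendsto (fun k => us (ns k) ω) atTop (𝓝 (u ω)) := by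
  obtain ⟨ns, -, hns⟩ := (tendstoInMeasure_of_tendsto_Lp h).exists_seq_tendsto_ae
  exact ⟨ns, hns⟩

lemma isClosed_essBall (r : ℝ) : IsClosed (essBall P r) := by
  refine IsSeqClosed.isClosed fun us u hus hu => ?_
  obtain ⟨ns, hns⟩ := exists_subseq_ae_tendsto hu
  have hall : ∀ᵐ ω ∂P, ∀ k, |us (ns k) ω| ≤ r := ae_all_iff.2 fun k => hus (ns k)
  filter_upwards [hns, hall] with ω h1 h2
  exact le_of_tendsto h1.abs (Eventually.of_forall h2)

lemma convex_essBall (r : ℝ) : Convex ℝ (essBall P r) := by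
  intro u hu v hv s t hs ht hst
  change ∀ᵐ ω ∂P, |u ω| ≤ r at hu
  change ∀ᵐ ω ∂P, |v ω| ≤ r at hv
  change ∀ᵐ ω ∂P, _
  filter_upwards [hu, hv, Lp.coeFn_add (s • u) (t • v), Lp.coeFn_smul s u, Lp.coeFn_smul t v]
    with ω h1 h2 h3 h4 h5
  rw [h3, Pi.add_apply, h4, h5, Pi.smul_apply, Pi.smul_apply, smul_eq_mul, smul_eq_mul]
  have h6 : r = s * r + t * r := by rw [← add_mul, hst, one_mul]
  calc |s * u ω + t * v ω| ≤ |s * u ω| + |t * v ω| := abs_add_le _ _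
    _ = s * |u ω| + t * |v ω| := by rw [abs_mul, abs_mul, abs_of_nonneg hs, abs_of_nonneg ht]
    _ ≤ s * r + t * r := by gcongr
    _ = r := h6.symm

lemma zero_mem_essBall {r : ℝ} (hr : 0 ≤ r) : (0 : Lp ℝ 2 P) ∈ essBall P r := by
  change ∀ᵐ ω ∂P, _
  filter_upwards [Lp.coeFn_zero ℝ 2 P] with ω h
  rw [h, Pi.zero_apply, abs_zero]
  exact hr

open scoped Pointwise in
lemma essBall_add_subset (r s : ℝ) : essBall P r + essBall P s ⊆ essBall P (r + s) := by
  rintro _ ⟨u, hu, v, hv, rfl⟩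
  change ∀ᵐ ω ∂P, |u ω| ≤ r at hu
  change ∀ᵐ ω ∂P, |v ω| ≤ s at hv
  change ∀ᵐ ω ∂P, _
  filter_upwards [hu, hv, Lp.coeFn_add u v] with ω h1 h2 h3
  simp only [h3, Pi.add_apply]
  exact (abs_add_le _ _).trans (add_le_add h1 h2)

lemma ae_abs_le_norm (z : Lp ℝ ∞ P) : ∀ᵐ ω ∂P, |z ω| ≤ ‖z‖ := by
  filter_upwards [ae_le_eLpNormEssSup (f := z) (μ := P)] with ω h
  rw [Lp.norm_def, eLpNorm_exponent_top]
  have hfin : eLpNormEssSup z P ≠ ∞ := by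
    have h := (Lp.memLp z).eLpNorm_ne_top
    rwa [eLpNorm_exponent_top] at h
  have h' := ENNReal.toReal_mono hfin h
  rwa [toReal_enorm] at h'

variable [IsProbabilityMeasure P]

lemma norm_le_of_mem_essBall {r : ℝ} (hr : 0 ≤ r) {u : Lp ℝ 2 P} (hu : u ∈ essBall P r) :
    ‖u‖ ≤ r := by
  have h := Lp.norm_le_of_ae_bound (f := u) hr hu
  simpa [measureUnivNNReal] using h

lemma isBounded_essBall {r : ℝ} (hr : 0 ≤ r) : Bornology.IsBounded (essBall P r) :=
  isBounded_iff_forall_norm_le.2 ⟨r, fun _ hu => norm_le_of_mem_essBall hr hu⟩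

/-- The inclusion of `L^∞(P)` in `L²(P)`. -/
def linftyToL2 (P : Measure Ω) [IsProbabilityMeasure P] : Lp ℝ ∞ P →ₗ[ℝ] Lp ℝ 2 P where
  toFun z := ⟨z.1, Lp.antitone le_top z.2⟩
  map_add' _ _ := rfl
  map_smul' _ _ := rfl

lemma coeFn_linftyToL2 (z : Lp ℝ ∞ P) : (linftyToL2 P z : Ω → ℝ) = z := rfl

lemma linftyToL2_injective : Function.Injective (linftyToL2 P) := fun _ _ h =>
  Subtype.ext (congrArg (fun u : Lp ℝ 2 P => u.1) h)

lemma exists_linftyToL2_eq_of_mem_essBall {r : ℝ} {u : Lp ℝ 2 P} (hu : u ∈ essBall P r) :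
    ∃ z : Lp ℝ ∞ P, linftyToL2 P z = u := by
  have hmem : MemLp u ∞ P := memLp_top_of_bound (Lp.aestronglyMeasurable u) r hu
  refine ⟨⟨u.1, hmem.2⟩, rfl⟩

lemma linftyToL2_mem_essBall (z : Lp ℝ ∞ P) : linftyToL2 P z ∈ essBall P ‖z‖ :=
  ae_abs_le_norm z

/-- Bounded almost sure convergence to `0` implies convergence in `L²`. -/
lemma tendsto_linftyToL2_zero {zs : ℕ → Lp ℝ ∞ P} {M : ℝ}
    (hM : ∀ n, ∀ᵐ ω ∂P, |zs n ω| ≤ M)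
    (hlim : ∀ᵐ ω ∂P, Tendsto (fun n => zs n ω) atTop (𝓝 0)) :
    Tendsto (fun n => ‖linftyToL2 P (zs n)‖) atTop (𝓝 0) := by
  have hui : UnifIntegrable (fun n => (zs n : Ω → ℝ)) 2 P := by
    refine unifIntegrable_of (by norm_num) (by norm_num)
      (fun n => Lp.aestronglyMeasurable (zs n)) fun ε _ => ⟨(|M| + 1).toNNReal, fun n => ?_⟩
    -- The threshold `|M| + 1` strictly exceeds the bound, so the truncated parts vanish almost
    -- surely.
    have hz : ({ω | (|M| + 1).toNNReal ≤ ‖zs n ω‖₊}.indicator (zs n)) =ᵐ[P] 0 := by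
      filter_upwards [hM n] with ω h
      refine Set.indicator_of_notMem ?_ _
      intro hmem
      have h1 : (|M| + 1).toNNReal ≤ ‖zs n ω‖₊ := hmem
      rw [Real.toNNReal_le_iff_le_coe, coe_nnnorm, Real.norm_eq_abs] at h1
      linarith [le_abs_self M]
    rw [eLpNorm_congr_ae hz]
    simp
  have h := tendsto_Lp_finite_of_tendsto_ae (p := 2) (g := (0 : Ω → ℝ)) (by norm_num)
    (by norm_num) (fun n => Lp.aestronglyMeasurable (zs n)) MemLp.zero hui hlim
  have h2 := (ENNReal.tendsto_toReal ENNReal.zero_ne_top).comp h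
  simp only [Function.comp_def, sub_zero, ENNReal.toReal_zero] at h2
  exact h2

/-- A linear functional on `L^∞(P)` that is continuous along bounded almost surely convergent
sequences. -/
def IsOrderContinuous (φ : Lp ℝ ∞ P →L[ℝ] ℝ) : Prop :=
  ∀ (zs : ℕ → Lp ℝ ∞ P) (M : ℝ), (∀ n, ∀ᵐ ω ∂P, |zs n ω| ≤ M) →
    (∀ᵐ ω ∂P, Tendsto (fun n => zs n ω) atTop (𝓝 0)) → Tendsto (fun n => φ (zs n)) atTop (𝓝 0)

/-- Closed under bounded almost sure convergence of sequences. -/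
def IsFatouClosed (C : Set (Lp ℝ ∞ P)) : Prop :=
  ∀ (zs : ℕ → Lp ℝ ∞ P) (z : Lp ℝ ∞ P) (M : ℝ), (∀ n, zs n ∈ C) →
    (∀ n, ∀ᵐ ω ∂P, |zs n ω| ≤ M) →
    (∀ᵐ ω ∂P, Tendsto (fun n => zs n ω) atTop (𝓝 (z ω))) → z ∈ C

lemma isClosed_image_inter_essBall {C : Set (Lp ℝ ∞ P)} (hC : IsFatouClosed C) (r : ℝ) :
    IsClosed (linftyToL2 P '' C ∩ essBall P r) := by
  refine IsSeqClosed.isClosed fun us u hus hu => ?_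
  have hmem : u ∈ essBall P r :=
    (isClosed_essBall r).mem_of_tendsto hu (Eventually.of_forall fun n => (hus n).2)
  obtain ⟨z, rfl⟩ := exists_linftyToL2_eq_of_mem_essBall hmem
  obtain ⟨ns, hns⟩ := exists_subseq_ae_tendsto hu
  choose zs hzs hzs' using fun n => (hus n).1
  refine ⟨⟨z, hC (fun k => zs (ns k)) z r (fun k => hzs _) (fun k => ?_) ?_, rfl⟩, hmem⟩
  · have h := (hus (ns k)).2
    rw [← hzs'] at h
    exact h
  · filter_upwards [hns] with ω h
    simp only [← hzs'] at h
    exact h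

/-- A convex set that is closed under bounded almost sure convergence and does not contain `0`
is separated from `0` by an order continuous functional. -/
theorem exists_isOrderContinuous_separating {C : Set (Lp ℝ ∞ P)} (hC : Convex ℝ C)
    (hF : IsFatouClosed C) (h0 : (0 : Lp ℝ ∞ P) ∉ C) :
    ∃ φ : Lp ℝ ∞ P →L[ℝ] ℝ, IsOrderContinuous φ ∧ ∃ c : ℝ, 0 < c ∧ ∀ z ∈ C, c ≤ φ z := by
  obtain ⟨U, hU, hUC, hUball⟩ := exists_convex_disjoint_of_isClosed_inter
    (B := fun n : ℕ => essBall P (n : ℝ)) (fun n => isClosed_essBall _)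
    (fun n => convex_essBall _) (fun n => isBounded_essBall n.cast_nonneg)
    (fun n => zero_mem_essBall n.cast_nonneg)
    (fun m n => by simpa using essBall_add_subset (P := P) (m : ℝ) (n : ℝ))
    (hC.linear_image (linftyToL2 P)) (fun n => isClosed_image_inter_essBall hF _)
    (by
      rintro ⟨z, hz, hz0⟩
      rw [← map_zero (linftyToL2 P)] at hz0
      exact h0 (linftyToL2_injective hz0 ▸ hz))
  set V : Set (Lp ℝ ∞ P) := linftyToL2 P ⁻¹' U with hV
  have hVconv : Convex ℝ V := hU.linear_preimage (linftyToL2 P)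
  have hVint : (0 : Lp ℝ ∞ P) ∈ interior V := by
    obtain ⟨ε, hε, h⟩ := hUball 1
    rw [mem_interior_iff_mem_nhds]
    refine mem_of_superset (Metric.ball_mem_nhds 0 (lt_min hε one_pos)) fun z hz => h ?_
    rw [mem_ball_zero_iff, lt_min_iff] at hz
    constructor
    · change ∀ᵐ ω ∂P, _
      rw [coeFn_linftyToL2, Nat.cast_one]
      filter_upwards [ae_abs_le_norm z] with ω h
      exact h.trans hz.2.le
    · rw [mem_closedBall_zero_iff]
      exact (norm_le_of_mem_essBall (norm_nonneg _) (linftyToL2_mem_essBall z)).trans hz.1.le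
  obtain ⟨φ, c, hφ, hφC⟩ := geometric_hahn_banach_open hVconv.interior isOpen_interior hC
    (Set.disjoint_left.2 fun z hz hzC =>
      Set.disjoint_left.1 hUC (interior_subset (s := V) hz) ⟨z, hzC, rfl⟩)
  have hc : 0 < c := by simpa using hφ 0 hVint
  -- Hahn–Banach bounds `φ` on the interior only; a convex set with nonempty interior lies in the
  -- closure of that interior.
  have hφV : ∀ z ∈ V, φ z ≤ c := by
    intro z hz
    have h1 : z ∈ closure (interior V) := by
      rw [hVconv.closure_interior_eq_closure_of_nonempty_interior ⟨0, hVint⟩]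
      exact subset_closure hz
    exact closure_minimal (fun w hw => (hφ w hw).le)
      (isClosed_le φ.continuous continuous_const) h1
  refine ⟨φ, fun zs M hM hlim => ?_, c, hc, hφC⟩
  have hL2 := tendsto_linftyToL2_zero hM hlim
  rw [Metric.tendsto_atTop']
  intro η hη
  -- Once `± K • zs n` lies in `V`, it follows that `|φ (zs n)| ≤ c / K < η`. The integer `m` bounds
  -- the scaled sequence, and its `L²` norm is eventually at most `ε`.
  obtain ⟨K, hK⟩ := exists_nat_gt (c / η)
  have hK0 : (0 : ℝ) < K := (div_pos hc hη).trans hK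
  obtain ⟨m, hm⟩ := exists_nat_ge (K * M)
  obtain ⟨ε, hε, h⟩ := hUball m
  obtain ⟨N, hN⟩ := eventually_atTop.1 (hL2.eventually (ge_mem_nhds (div_pos hε hK0)))
  refine ⟨N, fun n hn => ?_⟩
  have hsign : ∀ s : ℝ, |s| = K → s * φ (zs n) ≤ c := by
    intro s hs
    rw [← smul_eq_mul, ← map_smul]
    refine hφV _ (h ⟨?_, ?_⟩)
    · change ∀ᵐ ω ∂P, _
      rw [coeFn_linftyToL2]
      filter_upwards [hM n, Lp.coeFn_smul s (zs n)] with ω h1 h2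
      rw [h2, Pi.smul_apply, smul_eq_mul, abs_mul, hs]
      exact (mul_le_mul_of_nonneg_left h1 hK0.le).trans hm
    · rw [mem_closedBall_zero_iff, map_smul, norm_smul, Real.norm_eq_abs, hs]
      have h1 := hN n hn.le
      rw [le_div_iff₀ hK0] at h1
      linarith
  have h1 := hsign K (abs_of_pos hK0)
  have h2 := hsign (-K) (by rw [abs_neg, abs_of_pos hK0])
  rw [dist_zero_right, Real.norm_eq_abs]
  rw [div_lt_iff₀ hη] at hK
  refine abs_lt.2 ⟨?_, ?_⟩
  · refine lt_of_mul_lt_mul_left ?_ hK0.le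
    linarith
  · refine lt_of_mul_lt_mul_left ?_ hK0.le
    linarith

end Separation

/-! ### Positive order continuous functionals as integrals -/

section Representation

variable {P : Measure Ω} [IsProbabilityMeasure P]

/-- The class of the indicator function of a measurable set. -/
def indLp (P : Measure Ω) [IsProbabilityMeasure P] {s : Set Ω} (hs : MeasurableSet s) :
    Lp ℝ ∞ P :=
  indicatorConstLp ∞ hs (measure_ne_top P s) 1

lemma coeFn_indLp {s : Set Ω} (hs : MeasurableSet s) :
    (indLp P hs : Ω → ℝ) =ᵐ[P] s.indicator fun _ => 1 :=
  indicatorConstLp_coeFn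

lemma ae_abs_indLp_le {s : Set Ω} (hs : MeasurableSet s) : ∀ᵐ ω ∂P, |indLp P hs ω| ≤ 1 := by
  filter_upwards [coeFn_indLp (P := P) hs] with ω h
  rw [h]
  by_cases hω : ω ∈ s <;> simp [hω]

lemma ae_indLp_nonneg {s : Set Ω} (hs : MeasurableSet s) : ∀ᵐ ω ∂P, 0 ≤ indLp P hs ω := by
  filter_upwards [coeFn_indLp (P := P) hs] with ω h
  rw [h]
  exact Set.indicator_nonneg (fun _ _ => zero_le_one) _

lemma indLp_union {s t : Set Ω} (hs : MeasurableSet s) (ht : MeasurableSet t)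
    (hst : Disjoint s t) : indLp P (hs.union ht) = indLp P hs + indLp P ht :=
  indicatorConstLp_disjoint_union hs ht (measure_ne_top P s) (measure_ne_top P t) hst 1

lemma indLp_congr {s t : Set Ω} (hs : MeasurableSet s) (ht : MeasurableSet t) (h : s = t) :
    indLp P hs = indLp P ht := by
  subst h
  rfl

lemma indLp_eq_zero {s : Set Ω} (hs : MeasurableSet s) (h : P s = 0) : indLp P hs = 0 := by
  refine Lp.ext ?_
  filter_upwards [coeFn_indLp (P := P) hs, Lp.coeFn_zero ℝ ∞ P, measure_eq_zero_iff_ae_notMem.1 h]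
    with ω h1 h2 h3
  rw [h1, h2, Set.indicator_of_notMem h3, Pi.zero_apply]

/-- The remainder after `n` terms is `φ` of the indicator of a tail union. These indicators are
bounded by `1` and tend to `0` pointwise by disjointness, so order continuity applies. -/
lemma hasSum_indLp {φ : Lp ℝ ∞ P →L[ℝ] ℝ} (hφ : IsOrderContinuous φ)
    (hpos : ∀ z : Lp ℝ ∞ P, (∀ᵐ ω ∂P, 0 ≤ z ω) → 0 ≤ φ z) {f : ℕ → Set Ω}
    (hf : ∀ i, MeasurableSet (f i)) (hd : Pairwise (Function.onFun Disjoint f)) :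
    HasSum (fun i => φ (indLp P (hf i))) (φ (indLp P (MeasurableSet.iUnion hf))) := by
  have hr : ∀ n, MeasurableSet (⋃ i, f (i + n)) := fun n => MeasurableSet.iUnion fun i => hf _
  have hstep : ∀ n, indLp P (hr n) = indLp P (hf n) + indLp P (hr (n + 1)) := by
    intro n
    rw [← indLp_union]
    · refine indLp_congr _ _ ?_
      rw [← Set.union_iUnion_nat_succ]
      simp only [zero_add, add_assoc, add_comm 1 n]
    · refine Set.disjoint_iUnion_right.2 fun i => hd ?_
      omega
  have hsum : ∀ n, ∑ i ∈ Finset.range n, φ (indLp P (hf i)) =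
      φ (indLp P (MeasurableSet.iUnion hf)) - φ (indLp P (hr n)) := by
    intro n
    induction n with
    | zero =>
      rw [indLp_congr (MeasurableSet.iUnion hf) (hr 0) (by simp)]
      simp
    | succ n ih =>
      rw [Finset.sum_range_succ, ih, hstep n, map_add]
      ring
  rw [hasSum_iff_tendsto_nat_of_nonneg fun i => hpos _ (ae_indLp_nonneg _)]
  simp only [hsum]
  have htail : Tendsto (fun n => φ (indLp P (hr n))) atTop (𝓝 0) := by
    refine hφ _ 1 (fun n => ae_abs_indLp_le _) ?_
    filter_upwards [ae_all_iff.2 fun n => coeFn_indLp (P := P) (hr n)] with ω h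
    simp only [h]
    refine tendsto_const_nhds.congr' ?_
    by_cases hω : ∃ j, ω ∈ f j
    · obtain ⟨j, hj⟩ := hω
      filter_upwards [eventually_gt_atTop j] with n hn
      refine (Set.indicator_of_notMem ?_ _).symm
      rw [Set.mem_iUnion]
      rintro ⟨i, hi⟩
      exact Set.disjoint_left.1 (hd (show j ≠ i + n by omega)) hj hi
    · refine Eventually.of_forall fun n => (Set.indicator_of_notMem ?_ _).symm
      rw [Set.mem_iUnion]
      rintro ⟨i, hi⟩
      exact hω ⟨_, hi⟩
  simpa using htail.const_sub (φ (indLp P (MeasurableSet.iUnion hf)))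

/-- The measure given by a positive order continuous functional on `L^∞(P)`. -/
def functionalMeasure (φ : Lp ℝ ∞ P →L[ℝ] ℝ) (hφ : IsOrderContinuous φ)
    (hpos : ∀ z : Lp ℝ ∞ P, (∀ᵐ ω ∂P, 0 ≤ z ω) → 0 ≤ φ z) : Measure Ω :=
  Measure.ofMeasurable (fun _ hs => ENNReal.ofReal (φ (indLp P hs)))
    (by rw [indLp_eq_zero _ measure_empty, map_zero, ENNReal.ofReal_zero])
    (fun f hf hd => by
      have h := hasSum_indLp hφ hpos hf hd
      rw [← h.tsum_eq]
      exact ENNReal.ofReal_tsum_of_nonneg (fun i => hpos _ (ae_indLp_nonneg _)) h.summable)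

section

variable {φ : Lp ℝ ∞ P →L[ℝ] ℝ} (hφ : IsOrderContinuous φ)
  (hpos : ∀ z : Lp ℝ ∞ P, (∀ᵐ ω ∂P, 0 ≤ z ω) → 0 ≤ φ z)

lemma functionalMeasure_apply {s : Set Ω} (hs : MeasurableSet s) :
    functionalMeasure φ hφ hpos s = ENNReal.ofReal (φ (indLp P hs)) :=
  Measure.ofMeasurable_apply s hs

lemma functionalMeasure_absolutelyContinuous : functionalMeasure φ hφ hpos ≪ P :=
  Measure.AbsolutelyContinuous.mk fun s hs h => by
    rw [functionalMeasure_apply hφ hpos hs, indLp_eq_zero hs h, map_zero, ENNReal.ofReal_zero]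

lemma isFiniteMeasure_functionalMeasure : IsFiniteMeasure (functionalMeasure φ hφ hpos) :=
  ⟨by
    rw [functionalMeasure_apply hφ hpos MeasurableSet.univ]
    exact ENNReal.ofReal_lt_top⟩

lemma functional_toLp_simpleFunc (g : SimpleFunc Ω ℝ) :
    φ ((g.memLp_top P).toLp g) = ∫ ω, g ω ∂functionalMeasure φ hφ hpos := by
  have := isFiniteMeasure_functionalMeasure hφ hpos
  induction g using SimpleFunc.induction with
  | const c hs =>
    rename_i s
    have h1 : (((SimpleFunc.const Ω c).piecewise s hs (SimpleFunc.const Ω 0)).memLp_top P).toLp _ =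
        c • indLp P hs := by
      refine Lp.ext ?_
      refine (MemLp.coeFn_toLp _).trans ?_
      filter_upwards [Lp.coeFn_smul c (indLp P hs), coeFn_indLp (P := P) hs] with ω h2 h3
      rw [h2, Pi.smul_apply, h3]
      by_cases hω : ω ∈ s <;> simp [hω]
    rw [h1, map_smul]
    simp only [SimpleFunc.coe_piecewise, SimpleFunc.coe_const, Function.const_zero,
      Set.piecewise_eq_indicator]
    rw [integral_indicator hs]
    simp only [Function.const_apply, setIntegral_const, Measure.real,
      functionalMeasure_apply hφ hpos hs]
    rw [ENNReal.toReal_ofReal (hpos _ (ae_indLp_nonneg _)), smul_eq_mul, smul_eq_mul, mul_comm]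
  | add hd hf hg =>
    rename_i f g
    have h1 : ((f + g).memLp_top P).toLp _ =
        (f.memLp_top P).toLp _ + (g.memLp_top P).toLp _ := rfl
    rw [h1, map_add, hf, hg]
    simp only [SimpleFunc.coe_add, Pi.add_apply]
    rw [integral_add]
    · exact SimpleFunc.integrable_of_isFiniteMeasure _
    · exact SimpleFunc.integrable_of_isFiniteMeasure _

lemma functional_eq_integral (z : Lp ℝ ∞ P) :
    φ z = ∫ ω, z ω ∂functionalMeasure φ hφ hpos := by
  have := isFiniteMeasure_functionalMeasure hφ hpos
  have hac := functionalMeasure_absolutelyContinuous hφ hpos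
  have hmeas : Measurable (z : Ω → ℝ) := (Lp.stronglyMeasurable z).measurable
  set M := ‖z‖ with hM
  have h0 : (0 : ℝ) ∈ Set.Icc (-M) M := ⟨by simp [hM], norm_nonneg _⟩
  -- Approximants with values in `[-M, M]` serve both dominated convergence and order continuity of
  -- `φ`.
  let g : ℕ → SimpleFunc Ω ℝ := SimpleFunc.approxOn z hmeas (Set.Icc (-M) M) 0 h0
  have hgM : ∀ n ω, |g n ω| ≤ M := fun n ω =>
    abs_le.2 (SimpleFunc.approxOn_mem hmeas h0 n ω)
  have hlim : ∀ᵐ ω ∂P, Tendsto (fun n => g n ω) atTop (𝓝 (z ω)) := by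
    filter_upwards [ae_abs_le_norm z] with ω h
    exact SimpleFunc.tendsto_approxOn hmeas h0 (subset_closure (abs_le.1 h))
  have h1 : Tendsto (fun n => ∫ ω, g n ω ∂functionalMeasure φ hφ hpos) atTop
      (𝓝 (∫ ω, z ω ∂functionalMeasure φ hφ hpos)) :=
    tendsto_integral_of_dominated_convergence (fun _ => M)
      (fun n => (g n).aestronglyMeasurable) (integrable_const M)
      (fun n => Eventually.of_forall (hgM n)) (hac.ae_le hlim)
  have h2 : Tendsto (fun n => φ (((g n).memLp_top P).toLp _ - z)) atTop (𝓝 0) := by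
    have hcoe : ∀ n, (((g n).memLp_top P).toLp (g n) - z : Lp ℝ ∞ P) =ᵐ[P]
        fun ω => g n ω - z ω := fun n =>
      (Lp.coeFn_sub _ _).trans ((MemLp.coeFn_toLp _).sub (EventuallyEq.refl _ _))
    refine hφ _ (M + M) (fun n => ?_) ?_
    · filter_upwards [hcoe n, ae_abs_le_norm z] with ω h h'
      rw [h]
      exact (abs_sub _ _).trans (add_le_add (hgM n ω) h')
    · filter_upwards [ae_all_iff.2 hcoe, hlim] with ω h h'
      simp only [h]
      simpa using h'.sub_const (z ω)
  have h3 := h2.add_const (φ z)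
  simp only [map_sub, sub_add_cancel, zero_add, functional_toLp_simpleFunc hφ hpos] at h3
  exact tendsto_nhds_unique h3 h1

end

/-- A convex set that is solid downwards and closed under bounded almost sure convergence is
strictly separated from every point outside by an absolutely continuous probability measure. -/
theorem exists_acProb_integral_lt {C : Set (Lp ℝ ∞ P)} (hC : Convex ℝ C) (hF : IsFatouClosed C)
    (hsolid : ∀ z ∈ C, ∀ w : Lp ℝ ∞ P, (∀ᵐ ω ∂P, w ω ≤ z ω) → w ∈ C) {x : Lp ℝ ∞ P} (hx : x ∉ C) :
    ∃ Q ∈ acProb P, ∀ z ∈ C, ∫ ω, z ω ∂Q < ∫ ω, x ω ∂Q := by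
  rcases C.eq_empty_or_nonempty with rfl | ⟨z₀, hz₀⟩
  · exact ⟨P, ⟨inferInstance, Measure.AbsolutelyContinuous.rfl⟩, fun z hz => hz.elim⟩
  -- The point `x` is outside `C` exactly when `0` is outside `x - C`, so the separation from `0`
  -- applies to this reflected set.
  have hconv : Convex ℝ ((fun w => x - w) ⁻¹' C) := by
    intro a ha b hb s t hs ht hst
    have h := hC ha hb hs ht hst
    have heq : x - (s • a + t • b) = s • (x - a) + t • (x - b) := by
      rw [smul_sub, smul_sub, ← add_sub_add_comm, ← add_smul, hst, one_smul]
    simpa only [Set.mem_preimage, heq] using h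
  have hFatou : IsFatouClosed ((fun w => x - w) ⁻¹' C) := by
    intro zs z M hzs hM hlim
    refine hF (fun n => x - zs n) (x - z) (‖x‖ + M) hzs (fun n => ?_) ?_
    · filter_upwards [ae_abs_le_norm x, hM n, Lp.coeFn_sub x (zs n)] with ω h1 h2 h3
      rw [h3]
      exact (abs_sub _ _).trans (add_le_add h1 h2)
    · filter_upwards [hlim, ae_all_iff.2 fun n => Lp.coeFn_sub x (zs n), Lp.coeFn_sub x z]
        with ω h1 h2 h3
      simp only [h2, h3]
      exact h1.const_sub _
  obtain ⟨ψ, hψ, c, hc, hψC⟩ := exists_isOrderContinuous_separating hconv hFatou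
    (by simpa using hx)
  have hsep : ∀ z ∈ C, c ≤ ψ x - ψ z := by
    intro z hz
    rw [← map_sub]
    exact hψC _ (by simpa using hz)
  have hpos : ∀ w : Lp ℝ ∞ P, (∀ᵐ ω ∂P, 0 ≤ w ω) → 0 ≤ ψ w := by
    intro w hw
    by_contra! hneg
    -- Were `ψ w < 0` with `w ≥ 0`, the points `z₀ - n w` would stay in `C` by solidity while `ψ`
    -- grows without bound there.
    obtain ⟨n, hn⟩ := exists_nat_gt ((ψ x - ψ z₀) / -ψ w)
    rw [div_lt_iff₀ (neg_pos.2 hneg)] at hn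
    have hmem : z₀ - (n : ℝ) • w ∈ C := by
      refine hsolid z₀ hz₀ _ ?_
      filter_upwards [hw, Lp.coeFn_sub z₀ ((n : ℝ) • w), Lp.coeFn_smul (n : ℝ) w] with ω h1 h2 h3
      rw [h2, Pi.sub_apply, h3, Pi.smul_apply, smul_eq_mul]
      have := mul_nonneg n.cast_nonneg h1 (α := ℝ)
      linarith
    have h1 := hsep _ hmem
    rw [map_sub, map_smul, smul_eq_mul] at h1
    linarith
  set e := indLp P (MeasurableSet.univ (α := Ω)) with he
  have he1 : (e : Ω → ℝ) =ᵐ[P] fun _ => 1 := by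
    filter_upwards [coeFn_indLp (P := P) (MeasurableSet.univ (α := Ω))] with ω h
    simpa using h
  have hepos : 0 < ψ e := by
    refine lt_of_le_of_ne (hpos _ (ae_indLp_nonneg _)) fun h => ?_
    -- Since `x - z₀ ≤ ‖x - z₀‖ e`, the case `ψ e = 0` would give `ψ (x - z₀) ≤ 0`, against the
    -- separation.
    have h1 : 0 ≤ ψ (‖x - z₀‖ • e - (x - z₀)) := by
      refine hpos _ ?_
      filter_upwards [he1, Lp.coeFn_sub (‖x - z₀‖ • e) (x - z₀), Lp.coeFn_smul ‖x - z₀‖ e,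
        ae_abs_le_norm (x - z₀)] with ω h1 h2 h3 h4
      rw [h2, Pi.sub_apply, h3, Pi.smul_apply, smul_eq_mul, h1]
      linarith [(abs_le.1 h4).2]
    rw [map_sub, map_smul, ← h, map_sub] at h1
    have h2 := hsep _ hz₀
    simp only [smul_eq_mul, mul_zero] at h1
    linarith
  set φ : Lp ℝ ∞ P →L[ℝ] ℝ := (ψ e)⁻¹ • ψ with hφdef
  have hφ : IsOrderContinuous φ := fun zs M hM hlim => by
    simpa [hφdef] using (hψ zs M hM hlim).const_mul (ψ e)⁻¹
  have hφpos : ∀ w : Lp ℝ ∞ P, (∀ᵐ ω ∂P, 0 ≤ w ω) → 0 ≤ φ w := fun w hw =>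
    mul_nonneg (inv_nonneg.2 hepos.le) (hpos w hw)
  refine ⟨functionalMeasure φ hφ hφpos, ⟨⟨?_⟩, functionalMeasure_absolutelyContinuous hφ hφpos⟩,
    fun z hz => ?_⟩
  · rw [functionalMeasure_apply hφ hφpos MeasurableSet.univ, ← he]
    simp [hφdef, hepos.ne']
  · rw [← functional_eq_integral, ← functional_eq_integral]
    refine mul_lt_mul_of_pos_left ?_ (inv_pos.2 hepos)
    exact sub_pos.1 (hc.trans_le (hsep z hz))

end Representation

/-! ### The logarithmic chart of the cone, and means of logarithms -/

namespace LinftyPP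

variable {P : Measure Ω}

lemma ext_ae {X Y : LinftyPP P} (h : ∀ᵐ ω ∂P, (X : Lp ℝ ∞ P) ω = (Y : Lp ℝ ∞ P) ω) : X = Y :=
  Subtype.ext (Lp.ext h)

lemma ae_pos (X : LinftyPP P) : ∀ᵐ ω ∂P, 0 < (X : Lp ℝ ∞ P) ω := by
  obtain ⟨c, hc, h⟩ := X.2
  filter_upwards [h] with ω hω
  exact hc.trans_le hω

lemma memLp_log (X : LinftyPP P) : MemLp (fun ω => Real.log ((X : Lp ℝ ∞ P) ω)) ∞ P := by
  obtain ⟨c, hc0, hc⟩ := X.2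
  obtain ⟨C, hC⟩ := exists_upper X
  refine memLp_top_of_bound
    (Lp.aestronglyMeasurable (X : Lp ℝ ∞ P)).aemeasurable.log.aestronglyMeasurable
    (max |Real.log c| |Real.log C|) ?_
  filter_upwards [hc, hC] with ω h1 h2
  exact abs_le_max_abs_abs (Real.log_le_log hc0 h1) (Real.log_le_log (hc0.trans_le h1) h2)

/-- The class of `log X` in `L^∞(P)`. -/
def logLp (X : LinftyPP P) : Lp ℝ ∞ P := (memLp_log X).toLp _

lemma coeFn_logLp (X : LinftyPP P) :
    (logLp X : Ω → ℝ) =ᵐ[P] fun ω => Real.log ((X : Lp ℝ ∞ P) ω) :=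
  MemLp.coeFn_toLp _

/-- The position `exp z`, for `z` in `L^∞(P)`. -/
def expLp (z : Lp ℝ ∞ P) : LinftyPP P :=
  ofFun (fun ω => Real.exp (z ω))
    (Real.continuous_exp.comp_aestronglyMeasurable (Lp.aestronglyMeasurable z))
    ⟨Real.exp (-‖z‖), Real.exp_pos _, by
      filter_upwards [ae_abs_le_norm z] with ω h
      exact Real.exp_le_exp.2 (abs_le.1 h).1⟩
    ⟨Real.exp ‖z‖, by
      filter_upwards [ae_abs_le_norm z] with ω h
      exact Real.exp_le_exp.2 (abs_le.1 h).2⟩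

lemma coeFn_expLp (z : Lp ℝ ∞ P) :
    ((expLp z : LinftyPP P) : Lp ℝ ∞ P) =ᵐ[P] fun ω => Real.exp (z ω) :=
  coeFn_ofFun _ _ _ _

lemma expLp_logLp (X : LinftyPP P) : expLp (logLp X) = X := by
  refine ext_ae ?_
  filter_upwards [coeFn_expLp (logLp X), coeFn_logLp X, ae_pos X] with ω h1 h2 h3
  rw [h1, h2, Real.exp_log h3]

/-- This identity turns quasi-logconvexity of `ρ` into quasiconvexity of `z ↦ ρ (expLp z)`. -/
lemma expLp_add_smul {a b : ℝ} (h0 : 0 < a) (h1 : a < 1) (hab : a + b = 1) (z w : Lp ℝ ∞ P) :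
    expLp (a • z + b • w) = geom a h0 h1 (expLp z) (expLp w) := by
  refine ext_ae ?_
  have hg : ((geom a h0 h1 (expLp z) (expLp w) : LinftyPP P) : Lp ℝ ∞ P) =ᵐ[P] _ :=
    coeFn_ofFun _ _ _ _
  filter_upwards [hg, coeFn_expLp (a • z + b • w), coeFn_expLp z, coeFn_expLp w,
    Lp.coeFn_add (a • z) (b • w), Lp.coeFn_smul a z, Lp.coeFn_smul b w] with ω e1 e2 e3 e4 e5 e6 e7
  rw [e1, e2, e3, e4, e5, Pi.add_apply, e6, e7, Pi.smul_apply, Pi.smul_apply, smul_eq_mul,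
    smul_eq_mul, ← Real.exp_mul, ← Real.exp_mul, ← Real.exp_add, ← hab]
  congr 1
  ring

lemma coeFn_scale {l : ℝ} (hl : 0 < l) (X : LinftyPP P) :
    ((scale l hl X : LinftyPP P) : Lp ℝ ∞ P) =ᵐ[P] fun ω => l * (X : Lp ℝ ∞ P) ω :=
  coeFn_ofFun _ _ _ _

lemma scale_scale_of_mul_eq_one {k l : ℝ} (hk : 0 < k) (hl : 0 < l) (h : k * l = 1)
    (X : LinftyPP P) : scale k hk (scale l hl X) = X := by
  refine ext_ae ?_
  filter_upwards [coeFn_scale hk (scale l hl X), coeFn_scale hl X] with ω h1 h2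
  rw [h1, h2, ← mul_assoc, h, one_mul]

lemma coeFn_geom {a : ℝ} (h0 : 0 < a) (h1 : a < 1) (X Y : LinftyPP P) :
    ((geom a h0 h1 X Y : LinftyPP P) : Lp ℝ ∞ P) =ᵐ[P]
      fun ω => ((X : Lp ℝ ∞ P) ω) ^ a * ((Y : Lp ℝ ∞ P) ω) ^ (1 - a) :=
  coeFn_ofFun _ _ _ _

section Mean

variable {Q : Measure Ω}

lemma integrable_log (hQ : Q ∈ acProb P) (X : LinftyPP P) :
    Integrable (fun ω => Real.log ((X : Lp ℝ ∞ P) ω)) Q := by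
  have := hQ.1
  obtain ⟨c, hc0, hc⟩ := X.2
  obtain ⟨C, hC⟩ := exists_upper X
  refine Integrable.of_bound
    ((memLp_log X).aestronglyMeasurable.mono_ac hQ.2) (max |Real.log c| |Real.log C|) ?_
  filter_upwards [hQ.2.ae_le hc, hQ.2.ae_le hC] with ω h1 h2
  exact abs_le_max_abs_abs (Real.log_le_log hc0 h1) (Real.log_le_log (hc0.trans_le h1) h2)

lemma integral_logLp (hQ : Q ∈ acProb P) (X : LinftyPP P) : ∫ ω, logLp X ω ∂Q = meanLog Q X :=
  integral_congr_ae (hQ.2.ae_le (coeFn_logLp X))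

lemma meanLog_mono (hQ : Q ∈ acProb P) {X Y : LinftyPP P}
    (h : ∀ᵐ ω ∂P, (X : Lp ℝ ∞ P) ω ≤ (Y : Lp ℝ ∞ P) ω) : meanLog Q X ≤ meanLog Q Y := by
  refine integral_mono_ae (integrable_log hQ X) (integrable_log hQ Y) ?_
  filter_upwards [hQ.2.ae_le h, hQ.2.ae_le (ae_pos X)] with ω h1 h2
  exact Real.log_le_log h2 h1

lemma meanLog_scale (hQ : Q ∈ acProb P) {l : ℝ} (hl : 0 < l) (X : LinftyPP P) :
    meanLog Q (scale l hl X) = meanLog Q X + Real.log l := by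
  have := hQ.1
  have h : meanLog Q (scale l hl X) =
      ∫ ω, (Real.log ((X : Lp ℝ ∞ P) ω) + Real.log l) ∂Q := by
    refine integral_congr_ae ?_
    filter_upwards [hQ.2.ae_le (coeFn_scale hl X), hQ.2.ae_le (ae_pos X)] with ω h1 h2
    rw [h1, Real.log_mul hl.ne' h2.ne', add_comm]
  rw [h, integral_add (integrable_log hQ X) (integrable_const _)]
  simp [meanLog]

lemma meanLog_geom (hQ : Q ∈ acProb P) {a : ℝ} (h0 : 0 < a) (h1 : a < 1) (X Y : LinftyPP P) :
    meanLog Q (geom a h0 h1 X Y) = a * meanLog Q X + (1 - a) * meanLog Q Y := by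
  have h : meanLog Q (geom a h0 h1 X Y) =
      ∫ ω, (a * Real.log ((X : Lp ℝ ∞ P) ω) + (1 - a) * Real.log ((Y : Lp ℝ ∞ P) ω)) ∂Q := by
    refine integral_congr_ae ?_
    filter_upwards [hQ.2.ae_le (coeFn_geom h0 h1 X Y), hQ.2.ae_le (ae_pos X),
      hQ.2.ae_le (ae_pos Y)] with ω e1 e2 e3
    rw [e1, Real.log_mul (Real.rpow_pos_of_pos e2 _).ne' (Real.rpow_pos_of_pos e3 _).ne',
      Real.log_rpow e2, Real.log_rpow e3]
  rw [h, integral_add ((integrable_log hQ X).const_mul _) ((integrable_log hQ Y).const_mul _),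
    integral_const_mul, integral_const_mul]
  rfl

lemma tendsto_meanLog (hQ : Q ∈ acProb P) {Xs : ℕ → LinftyPP P} {X : LinftyPP P}
    (hmono : ∀ᵐ ω ∂P, Monotone (fun n => (Xs n : Lp ℝ ∞ P) ω))
    (hlim : ∀ᵐ ω ∂P, Tendsto (fun n => (Xs n : Lp ℝ ∞ P) ω) atTop (𝓝 ((X : Lp ℝ ∞ P) ω))) :
    Tendsto (fun n => meanLog Q (Xs n)) atTop (𝓝 (meanLog Q X)) := by
  refine integral_tendsto_of_tendsto_of_monotone (fun n => integrable_log hQ (Xs n))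
    (integrable_log hQ X) ?_ ?_
  · filter_upwards [hQ.2.ae_le hmono, hQ.2.ae_le (ae_pos (Xs 0))] with ω h1 h2 m n hmn
    exact Real.log_le_log (h2.trans_le (h1 (Nat.zero_le m))) (h1 hmn)
  · filter_upwards [hQ.2.ae_le hlim, hQ.2.ae_le (ae_pos X)] with ω h1 h2
    exact h1.log h2.ne'

end Mean

end LinftyPP

open LinftyPP

/-! ### Quasiconvex duality and the canonical functional -/

section RiskMeasure

variable {P : Measure Ω} {ρ : LinftyPP P → ℝ≥0∞}

lemma convex_setOf_risk_expLp_le (hq : IsQuasiLogconvex ρ) (m : ℝ≥0∞) :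
    Convex ℝ {z : Lp ℝ ∞ P | ρ (expLp z) ≤ m} := by
  rw [convex_iff_forall_pos]
  intro z hz w hw a b ha hb hab
  have h1 : a < 1 := by linarith
  rw [Set.mem_ofPred_eq, expLp_add_smul ha h1 hab]
  exact (hq _ _ a ha h1).trans (max_le hz hw)

/-- The infima of the tails lie below the sequence, so monotonicity keeps them in the sublevel set.
They increase to the limit, where continuity from below applies. -/
lemma isFatouClosed_setOf_risk_expLp_le [IsProbabilityMeasure P] (hm : IsMonotoneRisk ρ)
    (hc : IsContinuousFromBelow ρ) (m : ℝ≥0∞) :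
    IsFatouClosed {z : Lp ℝ ∞ P | ρ (expLp z) ≤ m} := by
  intro zs z M hzs hM hlim
  have hM' : ∀ᵐ ω ∂P, ∀ n, |zs n ω| ≤ M := ae_all_iff.2 hM
  have hbdd : ∀ {ω : Ω}, (∀ n, |zs n ω| ≤ M) → ∀ n,
      BddBelow (Set.range fun k => zs (n + k) ω) := fun h n =>
    ⟨-M, Set.forall_mem_range.2 fun k => (abs_le.1 (h _)).1⟩
  have hmeas : ∀ n, Measurable fun ω => ⨅ k, zs (n + k) ω := fun n =>
    Measurable.iInf fun k => (Lp.stronglyMeasurable (zs (n + k))).measurable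
  have hmem : ∀ n, MemLp (fun ω => ⨅ k, zs (n + k) ω) ∞ P := by
    intro n
    refine memLp_top_of_bound (hmeas n).aestronglyMeasurable M ?_
    filter_upwards [hM'] with ω h
    refine abs_le.2 ⟨le_ciInf fun k => (abs_le.1 (h _)).1, ?_⟩
    exact (ciInf_le (hbdd h n) 0).trans (abs_le.1 (h _)).2
  let ys : ℕ → Lp ℝ ∞ P := fun n => (hmem n).toLp _
  have hys : ∀ᵐ ω ∂P, ∀ n, (expLp (ys n) : Lp ℝ ∞ P) ω = Real.exp (⨅ k, zs (n + k) ω) := by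
    refine ae_all_iff.2 fun n => ?_
    filter_upwards [coeFn_expLp (ys n), (hmem n).coeFn_toLp] with ω h1 h2
    rw [h1, h2]
  have hle : ∀ n, ρ (expLp (ys n)) ≤ m := by
    intro n
    refine (hm _ _ ?_).trans (hzs n)
    filter_upwards [hys, hM', coeFn_expLp (zs n)] with ω h1 h2 h3
    rw [h1, h3]
    exact Real.exp_le_exp.2 (ciInf_le (hbdd h2 n) 0)
  refine le_of_tendsto' (hc (fun n => expLp (ys n)) (expLp z) ?_ ?_) hle
  · filter_upwards [hys, hM'] with ω h1 h2 i j hij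
    simp only [h1]
    refine Real.exp_le_exp.2 (le_ciInf fun k => ?_)
    have h3 := ciInf_le (hbdd h2 i) (j - i + k)
    have h4 : i + (j - i + k) = j + k := by omega
    simpa only [h4] using h3
  · filter_upwards [hys, hM', hlim, coeFn_expLp z] with ω h1 h2 h3 h4
    simp only [h1, h4]
    refine (Real.continuous_exp.tendsto _).comp (tendsto_order.2 ⟨fun a ha => ?_, fun a ha => ?_⟩)
    · obtain ⟨b, hab, hb⟩ := exists_between ha
      obtain ⟨N, hN⟩ := eventually_atTop.1 (h3.eventually (lt_mem_nhds hb))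
      filter_upwards [eventually_ge_atTop N] with n hn
      exact hab.trans_le (le_ciInf fun k => (hN _ (hn.trans (Nat.le_add_right _ _))).le)
    · filter_upwards [h3.eventually (gt_mem_nhds ha)] with n hn
      exact (ciInf_le (hbdd h2 n) 0).trans_lt hn

/-- A monotone, quasi-logconvex risk measure that is continuous from below is the supremum over
`Q` of its infima over the half spaces of `E_Q[log ·]`. -/
theorem risk_eq_iSup_iInf [IsProbabilityMeasure P] (hm : IsMonotoneRisk ρ)
    (hq : IsQuasiLogconvex ρ) (hc : IsContinuousFromBelow ρ) (X : LinftyPP P) :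
    ρ X = ⨆ Q : acProb P, ⨅ (Y : LinftyPP P) (_ : meanLog (Q : Measure Ω) X ≤ meanLog Q Y),
      ρ Y := by
  refine le_antisymm (le_of_forall_lt fun m hmX => ?_)
    (iSup_le fun Q => iInf₂_le (f := fun Y (_ : meanLog (Q : Measure Ω) X ≤ meanLog Q Y) => ρ Y)
      X le_rfl)
  -- The sublevel set at `m'` misses `log X`, and the gap above `m` leaves room for the infimum over
  -- `Y`.
  obtain ⟨m', hmm', hm'X⟩ := exists_between hmX
  obtain ⟨Q, hQ, hsep⟩ := exists_acProb_integral_lt (convex_setOf_risk_expLp_le hq m')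
    (isFatouClosed_setOf_risk_expLp_le hm hc m')
    (fun z hz w hwz => (hm _ _ (by
      filter_upwards [hwz, coeFn_expLp z, coeFn_expLp w] with ω h1 h2 h3
      rw [h2, h3]
      exact Real.exp_le_exp.2 h1)).trans hz)
    (x := logLp X) (by simpa [expLp_logLp] using hm'X)
  refine hmm'.trans_le (le_iSup_of_le ⟨Q, hQ⟩ (le_iInf₂ fun Y hY => ?_))
  by_contra! hlt
  have h := hsep (logLp Y) (by simpa [expLp_logLp] using hlt.le)
  rw [integral_logLp hQ, integral_logLp hQ] at h
  exact absurd hY (not_le.2 h)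

lemma isExpansive_iff_isMulExpansive_exp {S : Type*} (R : ℝ → S → EReal) :
    IsExpansive R ↔ IsMulExpansive (fun t Q => EReal.exp (R t Q)) := by
  refine forall₃_congr fun t h Q => imp_congr_right fun _ => ?_
  rw [← EReal.exp_coe, mul_comm, ← EReal.exp_add, EReal.exp_le_exp_iff]

lemma isIncreasingFst_canonicalR : IsIncreasingFst (canonicalR ρ) := fun _ _ _ hst =>
  le_iInf₂ fun Y hY => iInf₂_le Y (hst.trans hY)

lemma isExpansive_canonicalR (hs : IsStarShaped ρ) : IsExpansive (canonicalR ρ) := by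
  intro t h Q hh
  refine le_iInf₂ fun Y hY => ?_
  have hexp : Real.exp h * Real.exp (-h) = 1 := by rw [← Real.exp_add]; simp
  -- If `E_Q[log Y] ≥ t + h`, then `Z = e^(-h) Y` competes at level `t`, and star-shapedness
  -- compares `Z` with `Y = e^h Z`.
  set Z := scale (Real.exp (-h)) (Real.exp_pos _) Y with hZ
  have h1 : canonicalR ρ t Q ≤ ENNReal.log (ρ Z) := by
    refine iInf₂_le Z ?_
    rw [hZ, meanLog_scale Q.2, Real.log_exp]
    linarith
  have h2 := hs Z (Real.exp h) (Real.one_le_exp hh)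
  rw [scale_scale_of_mul_eq_one _ _ hexp] at h2
  calc canonicalR ρ t Q + h ≤ ENNReal.log (ρ Z) + h := by gcongr
    _ = ENNReal.log (ENNReal.ofReal (Real.exp h) * ρ Z) := by
      rw [ENNReal.log_mul_add, ENNReal.log_ofReal_of_pos (Real.exp_pos h), Real.log_exp, add_comm]
    _ ≤ ENNReal.log (ρ Y) := ENNReal.log_monotone h2

lemma isRepresentedBy_exp_canonicalR [IsProbabilityMeasure P] (hm : IsMonotoneRisk ρ)
    (hq : IsQuasiLogconvex ρ) (hc : IsContinuousFromBelow ρ) :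
    IsRepresentedBy ρ (acProb P) (fun t Q => EReal.exp (canonicalR ρ t Q)) := by
  intro X
  rw [risk_eq_iSup_iInf hm hq hc X]
  refine iSup_congr fun Q => ?_
  simp only [canonicalR, ← EReal.expOrderIso_apply, OrderIso.map_iInf]
  simp

/-- The left limits of `R` in the first argument. -/
def leftRegularization {S : Type*} (R : ℝ → S → ℝ≥0∞) (t : ℝ) (Q : S) : ℝ≥0∞ :=
  ⨆ (s : ℝ) (_ : s < t), R s Q

/-! ### Left continuity by passage to left limits -/

section LeftRegularization

variable {S : Type*} {R : ℝ → S → ℝ≥0∞}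

lemma le_leftRegularization {s t : ℝ} (h : s < t) (Q : S) : R s Q ≤ leftRegularization R t Q :=
  le_iSup₂ (f := fun s (_ : s < t) => R s Q) s h

lemma leftRegularization_le (hR : IsIncreasingFst R) (t : ℝ) (Q : S) :
    leftRegularization R t Q ≤ R t Q :=
  iSup₂_le fun _ hs => hR Q hs.le

lemma isIncreasingFst_leftRegularization : IsIncreasingFst (leftRegularization R) :=
  fun Q _ _ hst => iSup₂_le fun _ hr => le_leftRegularization (hr.trans_le hst) Q

lemma isContinuousFromBelowFst_leftRegularization :
    IsContinuousFromBelowFst (leftRegularization R) := by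
  intro Q t
  refine tendsto_order.2 ⟨fun a ha => ?_, fun a ha => ?_⟩
  · obtain ⟨s, hs⟩ := lt_iSup_iff.1 ha
    obtain ⟨hst, hs⟩ := lt_iSup_iff.1 hs
    filter_upwards [mem_nhdsWithin_of_mem_nhds (lt_mem_nhds hst)] with r hr
    exact hs.trans_le (le_leftRegularization hr Q)
  · filter_upwards [self_mem_nhdsWithin] with r hr
    exact (isIncreasingFst_leftRegularization Q hr).trans_lt ha

lemma IsMulExpansive.leftRegularization (hR : IsMulExpansive R) :
    IsMulExpansive (leftRegularization R) := by
  intro t h Q hh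
  simp only [_root_.leftRegularization, ENNReal.mul_iSup]
  exact iSup₂_le fun s hs =>
    (hR s h Q hh).trans (le_leftRegularization (add_lt_add_left hs h) Q)

end LeftRegularization

/-- Scaling `X` by `e^(-1/(n+1))` moves every `E_Q[log X]` strictly to the left, where `R` is below
its left limit. The scaled positions increase to `X`, so continuity from below recovers `ρ X`. -/
lemma IsRepresentedBy.leftRegularization {R : ℝ → acProb P → ℝ≥0∞}
    (hR : IsIncreasingFst R) (hc : IsContinuousFromBelow ρ)
    (hrep : IsRepresentedBy ρ (acProb P) R) :
    IsRepresentedBy ρ (acProb P) (leftRegularization R) := by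
  intro X
  refine le_antisymm ?_ ((iSup_mono fun Q => leftRegularization_le hR _ Q).trans (hrep X).ge)
  let l : ℕ → ℝ := fun n => Real.exp (-(1 / ((n : ℝ) + 1)))
  have hl : ∀ n, 0 < l n := fun n => Real.exp_pos _
  refine le_of_tendsto' (hc (fun n => scale (l n) (hl n) X) X ?_ ?_) fun n => ?_
  · filter_upwards [ae_pos X, ae_all_iff.2 fun n => coeFn_scale (hl n) X] with ω h1 h2 i j hij
    simp only [h2]
    exact mul_le_mul_of_nonneg_right
      (Real.exp_le_exp.2 (neg_le_neg (Nat.one_div_le_one_div hij))) h1.le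
  · filter_upwards [ae_all_iff.2 fun n => coeFn_scale (hl n) X] with ω h2
    simp only [h2]
    have h3 : Tendsto l atTop (𝓝 1) := by
      have h4 := (Real.continuous_exp.tendsto _).comp
        (tendsto_one_div_add_atTop_nhds_zero_nat (𝕜 := ℝ)).neg
      simpa [Function.comp_def, l] using h4
    simpa using h3.mul_const ((X : Lp ℝ ∞ P) ω)
  · rw [hrep]
    refine iSup_mono fun Q => le_leftRegularization ?_ Q
    rw [meanLog_scale Q.2, Real.log_exp]
    have : (0 : ℝ) < 1 / ((n : ℝ) + 1) := Nat.one_div_pos_of_nat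
    linarith

/-! ### From a representation back to the properties of the risk measure -/

section Represented

variable {𝒬 : Set (Measure Ω)} {R : ℝ → 𝒬 → ℝ≥0∞}

lemma IsRepresentedBy.isMonotoneRisk (h𝒬 : 𝒬 ⊆ acProb P) (hR : IsIncreasingFst R)
    (hrep : IsRepresentedBy ρ 𝒬 R) : IsMonotoneRisk ρ := by
  intro X Y hXY
  rw [hrep X, hrep Y]
  exact iSup_mono fun Q => hR Q (meanLog_mono (h𝒬 Q.2) hXY)

lemma IsRepresentedBy.isQuasiLogconvex (h𝒬 : 𝒬 ⊆ acProb P) (hR : IsIncreasingFst R)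
    (hrep : IsRepresentedBy ρ 𝒬 R) : IsQuasiLogconvex ρ := by
  intro X Y a h0 h1
  rw [hrep (geom a h0 h1 X Y), hrep X, hrep Y]
  refine iSup_le fun Q => ?_
  have hle : meanLog (Q : Measure Ω) (geom a h0 h1 X Y) ≤ max (meanLog Q X) (meanLog Q Y) := by
    rw [meanLog_geom (h𝒬 Q.2)]
    have e1 := mul_le_mul_of_nonneg_left (le_max_left (meanLog (Q : Measure Ω) X) (meanLog Q Y))
      h0.le
    have e2 := mul_le_mul_of_nonneg_left (le_max_right (meanLog (Q : Measure Ω) X) (meanLog Q Y))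
      (sub_nonneg.2 h1.le)
    linarith
  refine ((hR Q hle).trans_eq (hR Q).map_max).trans ?_
  exact max_le_max (le_iSup (fun Q : 𝒬 => R (meanLog (Q : Measure Ω) X) Q) Q)
    (le_iSup (fun Q : 𝒬 => R (meanLog (Q : Measure Ω) Y) Q) Q)

lemma IsRepresentedBy.isStarShaped (h𝒬 : 𝒬 ⊆ acProb P) (hR : IsMulExpansive R)
    (hrep : IsRepresentedBy ρ 𝒬 R) : IsStarShaped ρ := by
  intro X l hl
  have hl0 := zero_lt_one.trans_le hl
  rw [hrep X, hrep (scale l _ X), ENNReal.mul_iSup]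
  refine iSup_mono fun Q => ?_
  have h := hR (meanLog (Q : Measure Ω) X) (Real.log l) Q (Real.log_nonneg hl)
  rwa [Real.exp_log hl0, ← meanLog_scale (h𝒬 Q.2) hl0] at h

/-- Lower semicontinuity is the substantive half: one `Q` nearly attains the supremum at `X`, its
means converge from the left, and left continuity of `R` applies. The upper half is monotonicity. -/
lemma IsRepresentedBy.isContinuousFromBelow (h𝒬 : 𝒬 ⊆ acProb P) (hR : IsIncreasingFst R)
    (hRc : IsContinuousFromBelowFst R) (hrep : IsRepresentedBy ρ 𝒬 R) :
    IsContinuousFromBelow ρ := by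
  intro Xs X hmono hlim
  have hle : ∀ n, ∀ᵐ ω ∂P, (Xs n : Lp ℝ ∞ P) ω ≤ (X : Lp ℝ ∞ P) ω := by
    intro n
    filter_upwards [hmono, hlim] with ω h1 h2
    exact h1.ge_of_tendsto h2 n
  have hρ := hrep.isMonotoneRisk h𝒬 hR
  refine tendsto_order.2 ⟨fun a ha => ?_, fun a ha => ?_⟩
  · rw [hrep X] at ha
    obtain ⟨Q, hQ⟩ := lt_iSup_iff.1 ha
    have h1 : Tendsto (fun n => meanLog (Q : Measure Ω) (Xs n)) atTop
        (𝓝[Set.Iic (meanLog (Q : Measure Ω) X)] (meanLog (Q : Measure Ω) X)) :=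
      tendsto_nhdsWithin_iff.2 ⟨tendsto_meanLog (h𝒬 Q.2) hmono hlim,
        Eventually.of_forall fun n => meanLog_mono (h𝒬 Q.2) (hle n)⟩
    filter_upwards [((hRc Q _).tendsto.comp h1).eventually (lt_mem_nhds hQ)] with n hn
    rw [hrep (Xs n)]
    exact lt_of_lt_of_le hn (le_iSup (fun Q : 𝒬 => R (meanLog (Q : Measure Ω) (Xs n)) Q) Q)
  · exact Eventually.of_forall fun n => (hρ _ _ (hle n)).trans_lt ha

end Represented

end RiskMeasure

end

/-! ### The equivalences -/

theorem mainTheorem2 {Ω : Type*} [MeasurableSpace Ω] (P : Measure Ω) [IsProbabilityMeasure P]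
    (ρ : LinftyPP P → ℝ≥0∞) :
    List.TFAE [
      -- (a)
      IsMonotoneRisk ρ ∧ IsQuasiLogconvex ρ ∧ IsStarShaped ρ ∧ IsContinuousFromBelow ρ,
      -- (b), with all absolutely continuous probability measures
      ∃ R : ℝ → acProb P → EReal,
        IsIncreasingFst R ∧ IsContinuousFromBelowFst R ∧ IsExpansive R ∧
          IsRepresentedBy ρ (acProb P) (fun t Q => EReal.exp (R t Q)),
      -- (b), with some set of absolutely continuous probability measures
      ∃ 𝒬 : Set (Measure Ω), 𝒬 ⊆ acProb P ∧ ∃ R : ℝ → 𝒬 → EReal,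
        IsIncreasingFst R ∧ IsContinuousFromBelowFst R ∧ IsExpansive R ∧
          IsRepresentedBy ρ 𝒬 (fun t Q => EReal.exp (R t Q)),
      -- (c), with all absolutely continuous probability measures
      ∃ R : ℝ → acProb P → ℝ≥0∞,
        IsIncreasingFst R ∧ IsContinuousFromBelowFst R ∧ IsMulExpansive R ∧
          IsRepresentedBy ρ (acProb P) R,
      -- (c), with some set of absolutely continuous probability measures
      ∃ 𝒬 : Set (Measure Ω), 𝒬 ⊆ acProb P ∧ ∃ R : ℝ → 𝒬 → ℝ≥0∞,
        IsIncreasingFst R ∧ IsContinuousFromBelowFst R ∧ IsMulExpansive R ∧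
          IsRepresentedBy ρ 𝒬 R] ∧
    -- expansivity of `R` and multiplicative expansivity of `exp R` are the same
    (∀ (𝒬 : Set (Measure Ω)) (R : ℝ → 𝒬 → EReal),
      IsExpansive R ↔ IsMulExpansive (fun t Q => EReal.exp (R t Q))) ∧
    -- under (a), the functional given by the infimum formula is expansive and represents `ρ`
    (IsMonotoneRisk ρ ∧ IsQuasiLogconvex ρ ∧ IsStarShaped ρ ∧ IsContinuousFromBelow ρ →
      IsIncreasingFst (canonicalR ρ) ∧ IsExpansive (canonicalR ρ) ∧
        IsRepresentedBy ρ (acProb P) (fun t Q => EReal.exp (canonicalR ρ t Q))) := by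
  have hcan : IsMonotoneRisk ρ ∧ IsQuasiLogconvex ρ ∧ IsStarShaped ρ ∧ IsContinuousFromBelow ρ →
      IsIncreasingFst (canonicalR ρ) ∧ IsExpansive (canonicalR ρ) ∧
        IsRepresentedBy ρ (acProb P) (fun t Q => EReal.exp (canonicalR ρ t Q)) :=
    fun ⟨hm, hq, hs, hc⟩ => ⟨isIncreasingFst_canonicalR, isExpansive_canonicalR hs,
      isRepresentedBy_exp_canonicalR hm hq hc⟩
  refine ⟨?_, fun _ R => isExpansive_iff_isMulExpansive_exp R, hcan⟩
  tfae_have 1 → 4 := by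
    intro h
    obtain ⟨hinc, hexp, hrep⟩ := hcan h
    have hinc' : IsIncreasingFst fun t Q => EReal.exp (canonicalR ρ t Q) := fun Q =>
      EReal.exp_monotone.comp (hinc Q)
    exact ⟨_, isIncreasingFst_leftRegularization, isContinuousFromBelowFst_leftRegularization,
      ((isExpansive_iff_isMulExpansive_exp _).1 hexp).leftRegularization,
      hrep.leftRegularization hinc' h.2.2.2⟩
  tfae_have 4 → 2 := by
    rintro ⟨R, hinc, hcont, hexp, hrep⟩
    refine ⟨fun t Q => ENNReal.log (R t Q), fun Q => ENNReal.log_monotone.comp (hinc Q),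
      fun Q t => ENNReal.continuous_log.continuousAt.comp_continuousWithinAt (hcont Q t), ?_, ?_⟩
    · rw [isExpansive_iff_isMulExpansive_exp]
      simpa only [ENNReal.exp_log] using hexp
    · simpa only [ENNReal.exp_log] using hrep
  tfae_have 2 → 3 := fun h => ⟨acProb P, subset_rfl, h⟩
  tfae_have 3 → 5 := by
    rintro ⟨𝒬, h𝒬, R, hinc, hcont, hexp, hrep⟩
    exact ⟨𝒬, h𝒬, _, fun Q => EReal.exp_monotone.comp (hinc Q),
      fun Q t => ENNReal.continuous_exp.continuousAt.comp_continuousWithinAt (hcont Q t),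
      (isExpansive_iff_isMulExpansive_exp R).1 hexp, hrep⟩
  tfae_have 5 → 1 := by
    rintro ⟨𝒬, h𝒬, R, hinc, hcont, hexp, hrep⟩
    exact ⟨hrep.isMonotoneRisk h𝒬 hinc, hrep.isQuasiLogconvex h𝒬 hinc,
      hrep.isStarShaped h𝒬 hexp, hrep.isContinuousFromBelow h𝒬 hinc hcont⟩
  tfae_finish
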